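/- Let $\mathbb{F}$ be any field and let $S$ be any set of $5\times 5$ matrices over $\mathbb{F}$. A word of length $k$ in $S$ is a product $a_1\cdots a_k$ with $a_1,\ldots,a_k\in S$, where the only word of length $0$ is the identity matrix. Let $\ell(S)$ be the smallest integer $k\geq 0$ for which the $\mathbb{F}$-linear span of all words in $S$ of length at most $k$ is the full (unital) $\mathbb{F}$-subalgebra of $\mathrm{Mat}_5(\mathbb{F})$ generated by $S$. Then $\ell(S)\leq 8$. -/

import Mathlib

/-- The set `S^k` of words of length `k` in `S`: all products `a₁ ⋯ aₖ` with every `aᵢ ∈ S`.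
The only word of length `0` is the empty product `1`. -/
def wordsOfLength {A : Type*} [Monoid A] (S : Set A) (k : ℕ) : Set A :=
  {a | ∃ w : List A, w.length = k ∧ (∀ x ∈ w, x ∈ S) ∧ w.prod = a}

/-- The `F`-linear span of all words in `S` of length at most `k`. -/
def spanWordsLE (F : Type*) {A : Type*} [Field F] [Ring A] [Algebra F A] (S : Set A) (k : ℕ) :
    Submodule F A :=
  Submodule.span F {a | ∃ i ≤ k, a ∈ wordsOfLength S i}

/-- The length `ℓ(S)`: the smallest `k` for which the words in `S` of length at most `k` span the
full (unital) subalgebra generated by `S`. It is `⊤` if there is no such `k`. -/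
noncomputable def algLength (F : Type*) {A : Type*} [Field F] [Ring A] [Algebra F A] (S : Set A) :
    ℕ∞ :=
  sInf ((fun k : ℕ => (k : ℕ∞)) ''
    {k : ℕ | spanWordsLE F S k = Subalgebra.toSubmodule (Algebra.adjoin F S)})

/-! After base change to an algebraic closure, let `L` be the span of the identity and `S`, acting
on `V` of dimension `n ≤ 5`; the claim is that the powers of `L` stabilise by exponent `2n - 2`. An
invariant subspace allows induction on `n` (`pow_le_pow_of_invariant`), so let `L` act irreducibly.

If `L ^ (2n - 2)` is not everything, some `X ≠ 0` is trace-orthogonal to it. Left multiplication by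
a word of length `j` lowers the exponent of orthogonality by `j`, and a map of rank at most one
orthogonal to `L ^ (n - 1)` vanishes. Hence short words cannot shrink `X` to rank one. This forces
every element of `L` to satisfy a quadratic equation (`exists_quadratic`), so `L` is closed under `A
* B + B * A`, which in turn excludes nonzero maps of rank at most two orthogonal to `L ^ (2n - 3)`
(`eq_zero_of_finrank_range_le_two`). As `n ≤ 5`, one factor of the quadratic has rank at most two
and so annihilates `X`: elements of `L` are scalar on the range of `X`. That range is invariant,
hence `V`, and scalars do not act irreducibly when `n > 2`. -/

open Module

/-! ### Growth of orbits under an irreducible space -/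

section Orbits

variable {K V : Type*} [Field K] [AddCommGroup V] [Module K V]

/-- The span of all `a v` with `a` in the space `W` of endomorphisms and `v ∈ I`. -/
def endOrbit (W : Submodule K (End K V)) (I : Submodule K V) : Submodule K V :=
  Submodule.map₂ (LinearMap.id : End K V →ₗ[K] V →ₗ[K] V) W I

theorem apply_mem_endOrbit {W : Submodule K (End K V)} {I : Submodule K V} {a : End K V} {v : V}
    (ha : a ∈ W) (hv : v ∈ I) : a v ∈ endOrbit W I :=
  Submodule.apply_mem_map₂ (LinearMap.id : End K V →ₗ[K] V →ₗ[K] V) ha hv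

theorem endOrbit_le {W : Submodule K (End K V)} {I J : Submodule K V} :
    endOrbit W I ≤ J ↔ ∀ a ∈ W, ∀ v ∈ I, a v ∈ J :=
  Submodule.map₂_le

/-- A space of endomorphisms is irreducible if it preserves no proper nonzero subspace. -/
def ActsIrreducibly (L : Submodule K (End K V)) : Prop :=
  ∀ W : Submodule K V, (∀ a ∈ L, ∀ w ∈ W, a w ∈ W) → W = ⊥ ∨ W = ⊤

variable {L : Submodule K (End K V)}

theorem apply_mem_endOrbit_succ {I : Submodule K V} {k : ℕ} {a : End K V} (ha : a ∈ L) {v : V}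
    (hv : v ∈ endOrbit (L ^ k) I) : a v ∈ endOrbit (L ^ (k + 1)) I := by
  have : endOrbit (L ^ k) I ≤ (endOrbit (L ^ (k + 1)) I).comap a := by
    rw [endOrbit_le]
    intro b hb v hv
    have : a * b ∈ L ^ (k + 1) := by
      rw [pow_succ']; exact Submodule.mul_mem_mul ha hb
    exact apply_mem_endOrbit (a := a * b) this hv
  exact this hv

theorem endOrbit_pow_mono (h1 : 1 ≤ L) (I : Submodule K V) {j k : ℕ} (h : j ≤ k) :
    endOrbit (L ^ j) I ≤ endOrbit (L ^ k) I :=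
  Submodule.map₂_le_map₂_left (pow_le_pow_right' h1 h)

/-- An orbit that stops growing is invariant, hence all of `V`; until then each step adds a
dimension. -/
theorem min_finrank_le_finrank_endOrbit [FiniteDimensional K V] (h1 : 1 ≤ L)
    (hL : ActsIrreducibly L) {I : Submodule K V} (hI : I ≠ ⊥) (k : ℕ) :
    min (finrank K V) (finrank K I + k) ≤ finrank K (endOrbit (L ^ k) I) := by
  have hle : ∀ k, I ≤ endOrbit (L ^ k) I := fun k v hv ↦
    apply_mem_endOrbit (a := 1) (Submodule.one_le.mp (one_le_pow_of_one_le' h1 k)) hv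
  induction k with
  | zero => exact (min_le_right _ _).trans (Submodule.finrank_mono (hle 0))
  | succ k ih =>
    rcases (endOrbit_pow_mono h1 I (Nat.le_succ k)).lt_or_eq with h | h
    · have : _ < finrank K (endOrbit (L ^ (k + 1)) I) := Submodule.finrank_lt_finrank_of_lt h
      omega
    · have : endOrbit (L ^ (k + 1)) I = ⊤ := by
        rcases hL (endOrbit (L ^ k) I) (fun a ha w hw ↦ h ▸ apply_mem_endOrbit_succ ha hw)
          with h' | h'
        · exact absurd (le_bot_iff.mp (h' ▸ hle k)) hI
        · exact h.symm.trans h'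
      rw [this, finrank_top]
      exact min_le_left _ _

theorem endOrbit_pow_eq_top [FiniteDimensional K V] (h1 : 1 ≤ L)
    (hL : ActsIrreducibly L) {I : Submodule K V} (hI : I ≠ ⊥) {k : ℕ}
    (hk : finrank K V ≤ finrank K I + k) : endOrbit (L ^ k) I = ⊤ := by
  have := min_finrank_le_finrank_endOrbit h1 hL hI k
  rw [min_eq_left hk] at this
  exact Submodule.eq_top_of_finrank_eq (le_antisymm (Submodule.finrank_le _) this)

theorem exists_apply_eq_of_mem_endOrbit_span {W : Submodule K (End K V)} {u v : V}
    (h : v ∈ endOrbit W (K ∙ u)) : ∃ a ∈ W, a u = v := by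
  have : endOrbit W (K ∙ u) ≤ W.map (LinearMap.applyₗ u) := by
    rw [endOrbit_le]
    intro a ha w hw
    obtain ⟨c, rfl⟩ := Submodule.mem_span_singleton.mp hw
    exact ⟨c • a, W.smul_mem c ha, by simp⟩
  obtain ⟨a, ha, h⟩ := this h
  exact ⟨a, ha, h⟩

theorem exists_mem_pow_apply_eq [FiniteDimensional K V] (h1 : 1 ≤ L)
    (hL : ActsIrreducibly L) {u : V} (hu : u ≠ 0) {k : ℕ} (hk : finrank K V ≤ k + 1) (v : V) :
    ∃ a ∈ L ^ k, a u = v := by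
  apply exists_apply_eq_of_mem_endOrbit_span
  rw [endOrbit_pow_eq_top h1 hL (by simpa using hu) (by rw [finrank_span_singleton hu]; omega)]
  trivial

end Orbits

/-! ### Orthogonality for the trace form -/

section TraceOrthogonal

variable {K V : Type*} [Field K] [AddCommGroup V] [Module K V]

/-- `X` is orthogonal to the space `W` with respect to the trace form. -/
def TraceOrthogonal (W : Submodule K (End K V)) (X : End K V) : Prop :=
  ∀ w ∈ W, LinearMap.trace K V (X * w) = 0

theorem exists_traceOrthogonal_ne_zero [FiniteDimensional K V] {W : Submodule K (End K V)}
    (hW : W ≠ ⊤) : ∃ X, X ≠ 0 ∧ TraceOrthogonal W X := by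
  obtain ⟨φ, hφ, hW⟩ := Submodule.exists_le_ker_of_lt_top W hW.lt_top
  let T : End K V →ₗ[K] Dual K (End K V) :=
    (LinearMap.mul K (End K V)).compr₂ (LinearMap.trace K V)
  have hT : Function.Injective T := by
    rw [← LinearMap.ker_eq_bot, LinearMap.ker_eq_bot']
    intro X hX
    ext v
    rw [LinearMap.zero_apply, ← Module.forall_dual_apply_eq_zero_iff K]
    intro f
    have h : LinearMap.trace K V (X * f.smulRight v) = 0 := LinearMap.congr_fun hX (f.smulRight v)
    have : X * f.smulRight v = f.smulRight (X v) := by ext; simp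
    rwa [this, LinearMap.trace_smulRight] at h
  obtain ⟨X, hX⟩ := (LinearMap.injective_iff_surjective_of_finrank_eq_finrank
    (Subspace.dual_finrank_eq).symm).mp hT φ
  refine ⟨X, fun h ↦ hφ (by rw [← hX, h, map_zero]), fun w hw ↦ ?_⟩
  exact (LinearMap.congr_fun hX w).trans (hW hw)

variable {L : Submodule K (End K V)}

theorem TraceOrthogonal.mul_left {X a : End K V} {i j k : ℕ} (h : TraceOrthogonal (L ^ k) X)
    (h1 : 1 ≤ L) (ha : a ∈ L ^ j) (hk : i + j ≤ k) : TraceOrthogonal (L ^ i) (a * X) := by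
  intro w hw
  rw [mul_assoc, LinearMap.trace_mul_comm, mul_assoc]
  refine h _ (pow_le_pow_right' h1 hk ?_)
  rw [pow_add]
  exact Submodule.mul_mem_mul hw ha

theorem range_mul (a b : End K V) :
    LinearMap.range (a * b) = (LinearMap.range b).map a :=
  LinearMap.range_comp b a

theorem finrank_range_mul_le_left [FiniteDimensional K V] (a b : End K V) :
    finrank K (LinearMap.range (a * b)) ≤ finrank K (LinearMap.range a) :=
  Submodule.finrank_mono (LinearMap.range_comp_le_range b a)

theorem finrank_range_mul_le_right [FiniteDimensional K V] (a b : End K V) :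
    finrank K (LinearMap.range (a * b)) ≤ finrank K (LinearMap.range b) := by
  rw [range_mul]; exact Submodule.finrank_map_le _ _

theorem exists_smulRight_eq [FiniteDimensional K V] {Y : End K V}
    (hY : finrank K (LinearMap.range Y) ≤ 1) : ∃ (f : Dual K V) (u : V), Y = f.smulRight u := by
  obtain ⟨⟨u, hu⟩, h⟩ := finrank_le_one_iff.mp hY
  rcases eq_or_ne u 0 with rfl | hu0
  · refine ⟨0, 0, ?_⟩
    ext v
    obtain ⟨c, hc⟩ := h ⟨Y v, LinearMap.mem_range_self Y v⟩
    simpa using (congrArg Subtype.val hc).symm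
  · obtain ⟨g, hg⟩ : ∃ g : Dual K V, g u ≠ 0 := by
      by_contra! hg
      exact hu0 ((Module.forall_dual_apply_eq_zero_iff K u).mp hg)
    refine ⟨(g u)⁻¹ • g ∘ₗ Y, u, ?_⟩
    ext v
    obtain ⟨c, hc⟩ := h ⟨Y v, LinearMap.mem_range_self Y v⟩
    have hc : c • u = Y v := congrArg Subtype.val hc
    simp [← hc, mul_comm c, inv_mul_cancel_left₀ hg]

/-- For `Y = f.smulRight u` the trace of `Y * a` is `f (a u)`, and the vectors `a u` fill `V` unless
`u = 0`. -/
theorem TraceOrthogonal.eq_zero_of_finrank_range_le_one [FiniteDimensional K V] (h1 : 1 ≤ L)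
    (hL : ActsIrreducibly L) {Y : End K V} (hY : finrank K (LinearMap.range Y) ≤ 1) {k : ℕ}
    (hk : finrank K V ≤ k + 1) (h : TraceOrthogonal (L ^ k) Y) : Y = 0 := by
  obtain ⟨f, u, rfl⟩ := exists_smulRight_eq hY
  rcases eq_or_ne u 0 with rfl | hu
  · ext; simp
  have : f = 0 := by
    ext v
    obtain ⟨a, ha, rfl⟩ := exists_mem_pow_apply_eq h1 hL hu hk v
    have := h a ha
    rw [LinearMap.trace_mul_comm] at this
    have h2 : a * f.smulRight u = f.smulRight (a u) := by ext; simp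
    rwa [h2, LinearMap.trace_smulRight] at this
  ext; simp [this]

end TraceOrthogonal

/-! ### The irreducible case -/

section Irreducible

variable {K V : Type*} [Field K] [AddCommGroup V] [Module K V]

theorem finrank_map_add_finrank_ker_inf [FiniteDimensional K V] (a : End K V)
    (G : Submodule K V) :
    finrank K (G.map a) + finrank K (LinearMap.ker a ⊓ G : Submodule K V) = finrank K G := by
  have h := LinearMap.finrank_range_add_finrank_ker (a.domRestrict G)
  rw [LinearMap.range_domRestrict, LinearMap.ker_domRestrict] at h
  rw [← h, inf_comm, ← Submodule.map_comap_subtype, Submodule.finrank_map_subtype_eq]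

theorem finrank_map_lt [FiniteDimensional K V] {a : End K V} {G : Submodule K V} {v : V}
    (hv : v ∈ G) (hv0 : v ≠ 0) (h : a v = 0) : finrank K (G.map a) < finrank K G := by
  have h1 := finrank_map_add_finrank_ker_inf a G
  have h2 : 0 < finrank K (LinearMap.ker a ⊓ G : Submodule K V) :=
    Module.finrank_pos_iff_exists_ne_zero.mpr ⟨⟨v, h, hv⟩, fun e ↦ hv0 (congrArg Subtype.val e)⟩
  omega

theorem exists_eigenvector_mem [IsAlgClosed K] [FiniteDimensional K V] {A : End K V}
    {G : Submodule K V} (hG : ∀ v ∈ G, A v ∈ G) (h : G ≠ ⊥) :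
    ∃ μ : K, ∃ v ∈ G, v ≠ 0 ∧ A v = μ • v := by
  have : Nontrivial G := Submodule.nontrivial_iff_ne_bot.mpr h
  obtain ⟨μ, hμ⟩ := Module.End.exists_eigenvalue (A.restrict hG)
  obtain ⟨v, hv⟩ := hμ.exists_hasEigenvector
  exact ⟨μ, v, v.2, by simpa using hv.2, by simpa using congrArg Subtype.val hv.apply_eq_smul⟩

/-- A space `W` of endomorphisms with `dim (W * Y) ≥ dim V`, where `Y` has rank at most two,
contains some `M` for which `M * Y` has rank one. -/
theorem exists_mul_finrank_range_le_one [IsAlgClosed K] [FiniteDimensional K V]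
    {W : Submodule K (End K V)} {Y : End K V} (hY0 : Y ≠ 0)
    (hY : finrank K (LinearMap.range Y) ≤ 2)
    (hW : finrank K V ≤ finrank K (W.map (LinearMap.mulRight K Y))) :
    ∃ M ∈ W, M * Y ≠ 0 ∧ finrank K (LinearMap.range (M * Y)) ≤ 1 := by
  suffices ∃ M ∈ W, M * Y ≠ 0 ∧ (finrank K (LinearMap.range Y) ≤ 1 ∨
      ∃ v, Y v ≠ 0 ∧ M (Y v) = 0) by
    obtain ⟨M, hM, h0, h⟩ := this
    refine ⟨M, hM, h0, ?_⟩
    rcases h with h | ⟨v, hv, hMv⟩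
    · exact (finrank_range_mul_le_right M Y).trans h
    · have := finrank_map_lt (LinearMap.mem_range_self Y v) hv hMv
      rw [range_mul]; omega
  obtain ⟨v₁, hv₁⟩ : ∃ v, Y v ≠ 0 := by
    by_contra! h; exact hY0 (LinearMap.ext h)
  have : Nontrivial V := ⟨⟨_, _, hv₁⟩⟩
  set Z := W.map (LinearMap.mulRight K Y)
  let e : V → Z →ₗ[K] V := fun v ↦ (LinearMap.applyₗ v).domRestrict Z
  have hZ : ∀ z : Z, z ≠ 0 → ∃ M ∈ W, M * Y ≠ 0 ∧ z.1 = M * Y := by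
    rintro ⟨z, M, hM, rfl⟩ hz
    exact ⟨M, hM, by simpa using hz, rfl⟩
  by_cases hinj : Function.Injective (e v₁)
  · by_cases h2 : ∃ v₂, Y v₂ ∉ K ∙ Y v₁
    · obtain ⟨v₂, hv₂⟩ := h2
      have hfr := le_antisymm hW (LinearMap.finrank_le_finrank_of_injective hinj)
      let E := LinearEquiv.ofInjectiveOfFinrankEq (e v₁) hinj hfr.symm
      -- Evaluation at `v₁` identifies `Z` with `V`. An eigenvector of `z v₁ ↦ z v₂` gives `z = M *
      -- Y` vanishing at `v₂ - c • v₁`, where `Y` does not vanish.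
      obtain ⟨c, hc⟩ := Module.End.exists_eigenvalue (e v₂ ∘ₗ E.symm.toLinearMap : End K V)
      obtain ⟨v, hv⟩ := hc.exists_hasEigenvector
      obtain ⟨M, hM, h0, hz⟩ := hZ (E.symm v) (by simpa using hv.2)
      have e2 : (E.symm v).1 v₂ = c • v := hv.apply_eq_smul
      have e1 : (E.symm v).1 v₁ = v := E.apply_symm_apply v
      rw [hz] at e1 e2
      refine ⟨M, hM, h0, .inr ⟨v₂ - c • v₁, ?_, ?_⟩⟩
      · intro h
        rw [map_sub, map_smul, sub_eq_zero] at h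
        exact hv₂ (h ▸ Submodule.smul_mem _ c (Submodule.mem_span_singleton_self _))
      · change (M * Y) (v₂ - c • v₁) = 0
        rw [map_sub, map_smul, e1, e2, sub_self]
    · push Not at h2
      have : Nontrivial Z := Module.nontrivial_of_finrank_pos (R := K) (finrank_pos.trans_le hW)
      obtain ⟨z, hz⟩ := exists_ne (0 : Z)
      obtain ⟨M, hM, h0, -⟩ := hZ z hz
      refine ⟨M, hM, h0, .inl ?_⟩
      have : LinearMap.range Y ≤ K ∙ Y v₁ := by
        rintro _ ⟨v, rfl⟩; exact h2 v
      exact (Submodule.finrank_mono this).trans (finrank_span_singleton hv₁).le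
  · rw [← LinearMap.ker_eq_bot, Submodule.eq_bot_iff] at hinj
    push Not at hinj
    obtain ⟨z, hz, hz0⟩ := hinj
    obtain ⟨M, hM, h0, h⟩ := hZ z hz0
    refine ⟨M, hM, h0, .inr ⟨v₁, hv₁, ?_⟩⟩
    have : z.1 v₁ = 0 := hz
    rwa [h] at this

variable {L : Submodule K (End K V)}

theorem finrank_le_finrank_map_mulRight [FiniteDimensional K V] (h1 : 1 ≤ L)
    (hL : ActsIrreducibly L) {Y : End K V} (hY0 : Y ≠ 0) {k : ℕ} (hk : finrank K V ≤ k + 1) :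
    finrank K V ≤ finrank K ((L ^ k).map (LinearMap.mulRight K Y)) := by
  obtain ⟨v, hv⟩ : ∃ v, Y v ≠ 0 := by
    by_contra! h; exact hY0 (LinearMap.ext h)
  let f := (LinearMap.applyₗ (R := K) v : End K V →ₗ[K] V).domRestrict
    ((L ^ k).map (LinearMap.mulRight K Y))
  suffices Function.Surjective f by
    rw [← finrank_top, ← LinearMap.range_eq_top.mpr this]
    exact LinearMap.finrank_range_le f
  intro w
  obtain ⟨a, ha, h⟩ := exists_mem_pow_apply_eq h1 hL hv hk w
  exact ⟨⟨a * Y, a, ha, rfl⟩, h⟩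

theorem TraceOrthogonal.finrank_map_mulRight_lt [IsAlgClosed K] [FiniteDimensional K V]
    (h1 : 1 ≤ L) (hL : ActsIrreducibly L) {Y : End K V} (hY0 : Y ≠ 0)
    (hY : finrank K (LinearMap.range Y) ≤ 2) {j k : ℕ} (hk : finrank K V + j ≤ k + 1)
    (h : TraceOrthogonal (L ^ k) Y) :
    finrank K ((L ^ j).map (LinearMap.mulRight K Y)) < finrank K V := by
  by_contra! hj
  obtain ⟨M, hM, h0, hr⟩ := exists_mul_finrank_range_le_one hY0 hY hj
  have : TraceOrthogonal (L ^ (finrank K V - 1)) (M * Y) := by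
    rcases Nat.eq_zero_or_pos (finrank K V) with h' | h'
    · intro w _
      have := finrank_zero_iff.mp h'
      rw [show M * Y * w = 0 from Subsingleton.elim _ _, map_zero]
    · exact h.mul_left h1 hM (by omega)
  exact h0 (this.eq_zero_of_finrank_range_le_one h1 hL hr (by omega))

/-- The common hypotheses of a minimal counterexample: `X` is orthogonal to all words of length at
most `2 * dim V - 2` in a space acting irreducibly. -/
structure IsObstruction (L : Submodule K (End K V)) (X : End K V) : Prop where
  one_le : 1 ≤ L
  irreducible : ActsIrreducibly L
  ne_zero : X ≠ 0
  orthogonal : TraceOrthogonal (L ^ (2 * finrank K V - 2)) X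

namespace IsObstruction

theorem finrank_pos [FiniteDimensional K V] {X : End K V} (h : IsObstruction L X) :
    0 < finrank K V := by
  rw [Nat.pos_iff_ne_zero]
  intro h0
  have := finrank_zero_iff.mp h0
  exact h.ne_zero (Subsingleton.elim _ _)

variable [IsAlgClosed K] [FiniteDimensional K V] {X : End K V}

theorem two_lt_finrank_range (h : IsObstruction L X) : 2 < finrank K (LinearMap.range X) := by
  by_contra! hX
  have hn := h.finrank_pos
  have := h.orthogonal.finrank_map_mulRight_lt h.one_le h.irreducible h.ne_zero hX
    (j := finrank K V - 1) (by omega)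
  have := finrank_le_finrank_map_mulRight h.one_le h.irreducible h.ne_zero
    (k := finrank K V - 1) (by omega)
  omega

theorem two_lt_finrank (h : IsObstruction L X) : 2 < finrank K V :=
  h.two_lt_finrank_range.trans_le (Submodule.finrank_le _)

/-- For `a ∈ L ^ (n - 3)` the map `R * a * X` has rank at most one and is orthogonal to `L ^ (n -
1)`, hence zero. As `X` has rank at least three, the vectors `a (X v)` span `V`. -/
theorem eq_zero_of_mem_sq (h : IsObstruction L X) {R : End K V} (hR : R ∈ L ^ 2)
    (hr : finrank K (LinearMap.range R) ≤ 1) : R = 0 := by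
  have hX := h.two_lt_finrank_range
  have hn := h.two_lt_finrank
  rw [← LinearMap.ker_eq_top, eq_top_iff, ← endOrbit_pow_eq_top h.one_le h.irreducible
    (I := LinearMap.range X) (k := finrank K V - 3) (by
      rw [Ne, LinearMap.range_eq_bot]; exact h.ne_zero) (by omega), endOrbit_le]
  rintro a ha _ ⟨v, rfl⟩
  have hRa : R * a ∈ L ^ (2 + (finrank K V - 3)) := by
    rw [pow_add]; exact Submodule.mul_mem_mul hR ha
  have h0 : R * a * X = 0 := by
    refine (h.orthogonal.mul_left h.one_le hRa (i := finrank K V - 1)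
      (by omega)).eq_zero_of_finrank_range_le_one h.one_le h.irreducible ?_ (by omega)
    exact (finrank_range_mul_le_left _ _).trans ((finrank_range_mul_le_left _ _).trans hr)
  exact LinearMap.congr_fun h0 v

end IsObstruction

theorem sub_smul_one_mem (h1 : 1 ≤ L) {A : End K V} (hA : A ∈ L) (μ : K) :
    A - μ • (1 : End K V) ∈ L :=
  L.sub_mem hA (L.smul_mem μ (Submodule.one_le.mp h1))

/-- Multiply repeatedly by `A - μ`, with `μ` an eigenvalue of `A` on the current invariant subspace.
Each factor shrinks that subspace, so fewer than `d` factors suffice before the next one would give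
zero. -/
theorem exists_mul_range_le_ker [IsAlgClosed K] [FiniteDimensional K V] (h1 : 1 ≤ L)
    {A : End K V} (hA : A ∈ L) (d : ℕ) {G : Submodule K V} (hd : finrank K G ≤ d)
    (hG : ∀ v ∈ G, A v ∈ G) {Z : End K V} (hZ0 : Z ≠ 0) (hZ : LinearMap.range Z ≤ G) :
    ∃ j a, ∃ μ : K, j + 1 ≤ d ∧ a ∈ L ^ j ∧ a * Z ≠ 0 ∧
      LinearMap.range (a * Z) ≤ LinearMap.ker (A - μ • (1 : End K V)) ⊓ G := by
  have hne : G ≠ ⊥ := by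
    rintro rfl
    exact hZ0 (LinearMap.range_eq_bot.mp (le_bot_iff.mp hZ))
  induction d generalizing G Z with
  | zero => exact absurd (Submodule.finrank_eq_zero.mp (Nat.le_zero.mp hd)) hne
  | succ d ih =>
    obtain ⟨μ, v, hv, hv0, hAv⟩ := exists_eigenvector_mem hG hne
    set B := A - μ • (1 : End K V) with hB
    by_cases h0 : B * Z = 0
    · refine ⟨0, 1, μ, by omega, by rw [pow_zero]; exact Submodule.one_le.mp le_rfl, by simpa using hZ0, ?_⟩
      rw [one_mul, le_inf_iff]
      refine ⟨?_, hZ⟩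
      rintro _ ⟨w, rfl⟩
      exact LinearMap.congr_fun h0 w
    · have hBv : B v = 0 := by simp [hB, hAv]
      have hlt := finrank_map_lt hv hv0 hBv
      have hcomm : A * B = B * A := by simp [hB, mul_sub, sub_mul]
      have hinv : ∀ v ∈ G.map B, A v ∈ G.map B := by
        rintro _ ⟨w, hw, rfl⟩
        exact ⟨A w, hG w hw, (LinearMap.congr_fun hcomm w).symm⟩
      have hr : LinearMap.range (B * Z) ≤ G.map B := by
        rw [range_mul]; exact Submodule.map_mono hZ
      have hBG : G.map B ≤ G := by
        rintro _ ⟨w, hw, rfl⟩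
        exact G.sub_mem (hG w hw) (G.smul_mem μ hw)
      obtain ⟨j, a, ν, hj, ha, ha0, hra⟩ := ih (by omega) hinv h0 hr (by
        intro h
        exact h0 (LinearMap.range_eq_bot.mp (le_bot_iff.mp (h ▸ hr))))
      refine ⟨j + 1, a * B, ν, by omega, ?_, by rwa [mul_assoc], ?_⟩
      · rw [pow_succ]; exact Submodule.mul_mem_mul ha (sub_smul_one_mem h1 hA μ)
      · rw [mul_assoc]; exact hra.trans (inf_le_inf_left _ hBG)

/-- Were all eigenspaces of `A` in `G` at most lines, the preceding reduction would yield a nonzero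
map of rank one orthogonal to `L ^ (n - 1)`. -/
theorem TraceOrthogonal.exists_two_le_finrank_ker_inf [IsAlgClosed K] [FiniteDimensional K V]
    (h1 : 1 ≤ L) (hL : ActsIrreducibly L) {A : End K V} (hA : A ∈ L) {G : Submodule K V}
    (hG : ∀ v ∈ G, A v ∈ G) {Z : End K V} (hZ0 : Z ≠ 0) (hZ : LinearMap.range Z ≤ G) {k : ℕ}
    (hk : finrank K G + finrank K V ≤ k + 2) (h : TraceOrthogonal (L ^ k) Z) :
    ∃ μ : K, 2 ≤ finrank K (LinearMap.ker (A - μ • (1 : End K V)) ⊓ G : Submodule K V) := by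
  obtain ⟨j, a, μ, hj, ha, ha0, hr⟩ := exists_mul_range_le_ker h1 hA _ le_rfl hG hZ0 hZ
  refine ⟨μ, ?_⟩
  by_contra! hlt
  have := Submodule.finrank_mono hr
  have hV : 0 < finrank K V := by
    rw [Nat.pos_iff_ne_zero]
    intro h0
    have := finrank_zero_iff.mp h0
    exact hZ0 (Subsingleton.elim _ _)
  refine ha0 ((h.mul_left h1 ha (i := k - j) (by omega)).eq_zero_of_finrank_range_le_one h1 hL
    (by omega) (by omega))

/-! ### Obstructions in dimension at most five -/

namespace IsObstruction

variable [IsAlgClosed K] [FiniteDimensional K V] {X : End K V}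

theorem exists_quadratic (h : IsObstruction L X) (hn : finrank K V ≤ 5) {A : End K V}
    (hA : A ∈ L) :
    ∃ c d : K, (A - d • (1 : End K V)) * (A - c • (1 : End K V)) = 0 := by
  have hX := h.two_lt_finrank_range
  have h2 := h.two_lt_finrank
  obtain ⟨c, hc⟩ := h.orthogonal.exists_two_le_finrank_ker_inf h.one_le h.irreducible hA
    (G := ⊤) (fun _ _ ↦ trivial) h.ne_zero le_top (by rw [finrank_top]; omega)
  rw [inf_top_eq] at hc
  set N := A - c • (1 : End K V) with hN
  have hNL : N ∈ L := sub_smul_one_mem h.one_le hA c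
  have hrk := LinearMap.finrank_range_add_finrank_ker N
  have hcomm : A * N = N * A := by simp [hN, mul_sub, sub_mul]
  have hinv : ∀ v ∈ LinearMap.range N, A v ∈ LinearMap.range N := by
    rintro _ ⟨w, rfl⟩
    exact ⟨A w, (LinearMap.congr_fun hcomm w).symm⟩
  suffices ∃ d : K, finrank K (LinearMap.range ((A - d • (1 : End K V)) * N)) ≤ 1 by
    obtain ⟨d, hd⟩ := this
    refine ⟨c, d, h.eq_zero_of_mem_sq ?_ hd⟩
    rw [pow_two]
    exact Submodule.mul_mem_mul (sub_smul_one_mem h.one_le hA d) hNL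
  -- If `N * X = 0`, then `ker N` has dimension at least three and `N` rank at most two, so one
  -- eigenvector in its range suffices. Otherwise `N` has rank at most three and a two-dimensional
  -- eigenspace in its range is needed.
  by_cases h0 : N * X = 0
  · have hle : LinearMap.range X ≤ LinearMap.ker N := by
      rintro _ ⟨v, rfl⟩
      exact LinearMap.congr_fun h0 v
    have := Submodule.finrank_mono hle
    by_cases hbot : LinearMap.range N = ⊥
    · refine ⟨0, ?_⟩
      rw [range_mul, hbot, Submodule.map_bot, finrank_bot]
      omega
    · obtain ⟨μ, v, hv, hv0, hAv⟩ := exists_eigenvector_mem hinv hbot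
      refine ⟨μ, ?_⟩
      have := finrank_map_lt (a := A - μ • (1 : End K V)) hv hv0 (by simp [hAv])
      rw [range_mul]
      omega
  · have hNX : TraceOrthogonal (L ^ (2 * finrank K V - 3)) (N * X) :=
      h.orthogonal.mul_left h.one_le (j := 1) (by simpa using hNL) (by omega)
    obtain ⟨d, hd⟩ := hNX.exists_two_le_finrank_ker_inf h.one_le h.irreducible hA hinv h0
      (LinearMap.range_comp_le_range X N) (by omega)
    refine ⟨d, ?_⟩
    have := finrank_map_add_finrank_ker_inf (A - d • (1 : End K V)) (LinearMap.range N)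
    rw [range_mul]
    omega

theorem mul_self_mem (h : IsObstruction L X) (hn : finrank K V ≤ 5) {A : End K V}
    (hA : A ∈ L) : A * A ∈ L := by
  obtain ⟨c, d, hcd⟩ := h.exists_quadratic hn hA
  have : A * A = (c + d) • A - (d * c) • (1 : End K V) := by
    simp only [sub_mul, mul_sub, smul_mul_assoc, mul_smul_comm, one_mul, mul_one] at hcd
    rw [← sub_eq_zero, ← hcd]
    module
  rw [this]
  exact L.sub_mem (L.smul_mem _ hA) (L.smul_mem _ (Submodule.one_le.mp h.one_le))

theorem mul_add_mul_mem (h : IsObstruction L X) (hn : finrank K V ≤ 5) {A B : End K V}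
    (hA : A ∈ L) (hB : B ∈ L) : A * B + B * A ∈ L := by
  have : A * B + B * A = (A + B) * (A + B) - A * A - B * B := by noncomm_ring
  rw [this]
  exact L.sub_mem (L.sub_mem (h.mul_self_mem hn (L.add_mem hA hB)) (h.mul_self_mem hn hA))
    (h.mul_self_mem hn hB)

/-- The spaces `L ^ j * Y` grow strictly up to `j = n - 1`, yet have dimension below `n` at `j = n -
2`; hence `L * Y` has dimension at most two. Closure of `L` under the Jordan product then gives `L ^
2 * Y = L * Y`, contradicting growth. -/
theorem eq_zero_of_finrank_range_le_two (h : IsObstruction L X) (hn : finrank K V ≤ 5)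
    {Y : End K V} (hY : finrank K (LinearMap.range Y) ≤ 2)
    (hYo : TraceOrthogonal (L ^ (2 * finrank K V - 3)) Y) : Y = 0 := by
  by_contra hY0
  have h2 := h.two_lt_finrank
  let D : ℕ → Submodule K (End K V) := fun j ↦ (L ^ j).map (LinearMap.mulRight K Y)
  have hmono : ∀ j, D j ≤ D (j + 1) := fun j ↦
    Submodule.map_mono (pow_le_pow_right' h.one_le (Nat.le_succ j))
  have hmul : ∀ j, ∀ a ∈ L, ∀ z ∈ D j, a * z ∈ D (j + 1) := by
    rintro j a ha _ ⟨b, hb, rfl⟩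
    refine ⟨a * b, ?_, mul_assoc a b Y⟩
    rw [pow_succ']
    exact Submodule.mul_mem_mul ha hb
  have hstab : ∀ i, D (i + 1) = D i → ∀ k, D (i + k) = D i := by
    intro i hi k
    induction k with
    | zero => rfl
    | succ k ih =>
      refine le_antisymm ?_ (ih.ge.trans (hmono _))
      rintro _ ⟨b, hb, rfl⟩
      rw [SetLike.mem_coe, ← add_assoc, pow_succ'] at hb
      refine Submodule.mul_induction_on hb (fun a ha c hc ↦ ?_) (fun x y hx hy ↦ ?_)
      · rw [← hi]
        have := hmul i a ha (c * Y) (ih ▸ ⟨c, hc, rfl⟩)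
        simpa [mul_assoc] using this
      · rw [map_add]; exact add_mem hx hy
  have hsmall : finrank K (D (finrank K V - 2)) < finrank K V :=
    hYo.finrank_map_mulRight_lt h.one_le h.irreducible hY0 hY (by omega)
  have hne : ∀ i, i ≤ finrank K V - 2 → D (i + 1) ≠ D i := by
    intro i hin hi
    have h3 : finrank K V ≤ finrank K (D (i + (finrank K V - 1))) :=
      finrank_le_finrank_map_mulRight h.one_le h.irreducible hY0 (by omega)
    rw [hstab i hi] at h3
    exact absurd (Submodule.finrank_mono (monotone_nat_of_le_succ hmono hin)) (by omega)
  have hgrow : ∀ k, 1 + k ≤ finrank K V - 2 → finrank K (D 1) + k ≤ finrank K (D (1 + k)) := by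
    intro k hk
    induction k with
    | zero => rfl
    | succ k ih =>
      have := Submodule.finrank_lt_finrank_of_lt
        ((hmono (1 + k)).lt_of_ne (hne (1 + k) (by omega)).symm)
      have := ih (by omega)
      rw [← add_assoc 1 k 1]
      omega
  have hD1 : finrank K (D 1) ≤ 2 := by
    have := hgrow (finrank K V - 3) (by omega)
    rw [show 1 + (finrank K V - 3) = finrank K V - 2 by omega] at this
    omega
  have hLY : ∀ a ∈ L, a * Y ∈ D 1 := fun a ha ↦ ⟨a, by simpa using ha, rfl⟩
  have hD1' : ∀ z ∈ D 1, ∃ a ∈ L, a * Y = z := by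
    rintro _ ⟨a, ha, rfl⟩
    exact ⟨a, by simpa using ha, rfl⟩
  have hYD : Y ∈ D 1 := by simpa using hLY 1 (Submodule.one_le.mp h.one_le)
  obtain ⟨B, hB, hBY⟩ : ∃ B ∈ L, B * Y ∉ K ∙ Y := by
    by_contra! hall
    refine hne 0 (by omega) (le_antisymm ?_ (hmono 0))
    intro z hz
    obtain ⟨a, ha, rfl⟩ := hD1' z hz
    obtain ⟨c, hc⟩ := Submodule.mem_span_singleton.mp (hall a ha)
    rw [← hc]
    refine Submodule.smul_mem _ c ⟨1, ?_, one_mul Y⟩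
    rw [pow_zero]
    exact Submodule.one_le.mp le_rfl
  have hspan : (K ∙ Y) ⊔ (K ∙ B * Y) = D 1 := by
    have hle : (K ∙ Y) ⊔ (K ∙ B * Y) ≤ D 1 := by
      simpa [Submodule.span_singleton_le_iff_mem] using ⟨hYD, hLY B hB⟩
    refine Submodule.eq_of_le_of_finrank_le hle (hD1.trans ?_)
    have hlt : (K ∙ Y) < (K ∙ Y) ⊔ (K ∙ B * Y) := by
      refine lt_of_le_of_ne le_sup_left fun he ↦ hBY ?_
      rw [he]
      exact Submodule.mem_sup_right (Submodule.mem_span_singleton_self _)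
    have := Submodule.finrank_lt_finrank_of_lt hlt
    rwa [finrank_span_singleton hY0] at this
  have hcoord : ∀ A ∈ L, ∃ a b : K, A * Y = a • Y + b • (B * Y) := by
    intro A hA
    have := hLY A hA
    rw [← hspan, Submodule.mem_sup] at this
    obtain ⟨y, hy, z, hz, hyz⟩ := this
    obtain ⟨a, rfl⟩ := Submodule.mem_span_singleton.mp hy
    obtain ⟨b, rfl⟩ := Submodule.mem_span_singleton.mp hz
    exact ⟨a, b, hyz.symm⟩
  have hAB : ∀ A ∈ L, A * (B * Y) ∈ D 1 := by
    intro A hA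
    obtain ⟨a, b, hab⟩ := hcoord A hA
    let C := A - a • (1 : End K V) - b • B
    have hC : C ∈ L := L.sub_mem (sub_smul_one_mem h.one_le hA a) (L.smul_mem b hB)
    have hCY : C * Y = 0 := by simp [C, sub_mul, hab]
    -- Since `C * Y = 0`, the product `C * B * Y` equals `(C * B + B * C) * Y`, with the bracket in
    -- `L`.
    have : A * (B * Y) = (C * B + B * C) * Y + a • (B * Y) + b • (B * B * Y) := by
      rw [add_mul, mul_assoc B C, hCY]
      simp only [C, sub_mul, smul_mul_assoc, one_mul, mul_zero, mul_assoc]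
      abel
    rw [this]
    exact add_mem (add_mem (hLY _ (h.mul_add_mul_mem hn hC hB)) (Submodule.smul_mem _ a (hLY B hB)))
      (Submodule.smul_mem _ b (hLY _ (h.mul_self_mem hn hB)))
  refine hne 1 (by omega) (le_antisymm ?_ (hmono 1))
  rintro _ ⟨b, hb, rfl⟩
  rw [SetLike.mem_coe, pow_two] at hb
  refine Submodule.mul_induction_on hb (fun A hA A' hA' ↦ ?_) (fun x y hx hy ↦ ?_)
  · obtain ⟨a, b, hab⟩ := hcoord A' hA'
    rw [LinearMap.mulRight_apply, mul_assoc, hab, mul_add, mul_smul_comm, mul_smul_comm]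
    exact add_mem (Submodule.smul_mem _ a (hLY A hA)) (Submodule.smul_mem _ b (hAB A hA))
  · rw [map_add]; exact add_mem hx hy

theorem exists_mul_eq_smul (h : IsObstruction L X) (hn : finrank K V ≤ 5) {A : End K V}
    (hA : A ∈ L) : ∃ c : K, (A - c • (1 : End K V)) * X = 0 := by
  obtain ⟨c, d, hcd⟩ := h.exists_quadratic hn hA
  have h2 := h.two_lt_finrank
  have key : ∀ c : K, finrank K (LinearMap.range (A - c • (1 : End K V))) ≤ 2 →
      (A - c • (1 : End K V)) * X = 0 := by
    intro c hc
    refine h.eq_zero_of_finrank_range_le_two hn ((finrank_range_mul_le_left _ _).trans hc) ?_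
    exact h.orthogonal.mul_left h.one_le (j := 1)
      (by simpa using sub_smul_one_mem h.one_le hA c) (by omega)
  have hle : LinearMap.range (A - c • (1 : End K V)) ≤ LinearMap.ker (A - d • (1 : End K V)) := by
    rintro _ ⟨v, rfl⟩
    exact LinearMap.congr_fun hcd v
  have h3 := Submodule.finrank_mono hle
  have h4 := LinearMap.finrank_range_add_finrank_ker (A - d • (1 : End K V))
  by_cases hc : finrank K (LinearMap.range (A - c • (1 : End K V))) ≤ 2
  · exact ⟨c, key c hc⟩
  · exact ⟨d, key d (by omega)⟩

theorem five_lt_finrank (h : IsObstruction L X) : 5 < finrank K V := by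
  by_contra! hn
  have h2 := h.two_lt_finrank
  have htop : LinearMap.range X = ⊤ := by
    refine (h.irreducible _ ?_).resolve_left fun h0 ↦ h.ne_zero (LinearMap.range_eq_bot.mp h0)
    rintro A hA _ ⟨v, rfl⟩
    obtain ⟨c, hc⟩ := h.exists_mul_eq_smul hn hA
    refine ⟨c • v, ?_⟩
    have := LinearMap.congr_fun hc v
    simp only [Module.End.mul_apply, LinearMap.sub_apply, LinearMap.smul_apply,
      Module.End.one_apply, LinearMap.zero_apply, sub_eq_zero] at this
    rw [map_smul, this]
  have hscal : ∀ A ∈ L, ∃ c : K, ∀ v, A v = c • v := by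
    intro A hA
    obtain ⟨c, hc⟩ := h.exists_mul_eq_smul hn hA
    refine ⟨c, fun v ↦ ?_⟩
    obtain ⟨w, rfl⟩ := LinearMap.range_eq_top.mp htop v
    have := LinearMap.congr_fun hc w
    simpa [sub_eq_zero] using this
  have : Nontrivial V := Module.nontrivial_of_finrank_pos (R := K) h.finrank_pos
  obtain ⟨v, hv⟩ := exists_ne (0 : V)
  have hfr := finrank_span_singleton (K := K) hv
  rcases h.irreducible (K ∙ v) (by
    rintro A hA w hw
    obtain ⟨c, hc⟩ := hscal A hA
    rw [hc]
    exact Submodule.smul_mem _ c hw) with h' | h'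
  · rw [h', finrank_bot] at hfr; omega
  · rw [h', finrank_top] at hfr; omega

end IsObstruction

theorem ActsIrreducibly.pow_eq_top [IsAlgClosed K] [FiniteDimensional K V] (h1 : 1 ≤ L)
    (hL : ActsIrreducibly L) (hn : finrank K V ≤ 5) : L ^ (2 * finrank K V - 2) = ⊤ := by
  by_contra hne
  obtain ⟨X, hX0, hX⟩ := exists_traceOrthogonal_ne_zero hne
  exact absurd (IsObstruction.five_lt_finrank ⟨h1, hL, hX0, hX⟩) (by omega)

end Irreducible

/-! ### Reduction along an invariant subspace -/

section Reduction

/-- A subalgebra `P` of pairs relating the letters of `L` and `M` relates words of the same length,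
so bounds on the length of words in `M` can be transferred to `L`. -/
theorem exists_intertwining_pow {R A B : Type*} [CommSemiring R] [Semiring A] [Semiring B]
    [Algebra R A] [Algebra R B] (P : Subalgebra R (A × B)) {L : Submodule R A}
    {M : Submodule R B} (hLM : ∀ a ∈ L, ∃ b ∈ M, (a, b) ∈ P) (hML : ∀ b ∈ M, ∃ a ∈ L, (a, b) ∈ P)
    {k l : ℕ} (hM : M ^ k ≤ M ^ l) {x : A} (hx : x ∈ L ^ k) :
    ∃ y ∈ L ^ l, ∃ b, (x, b) ∈ P ∧ (y, b) ∈ P := by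
  let Q : Submodule R (A × B) := P.toSubmodule ⊓ Submodule.prod L M
  have hfst : Q.map (AlgHom.fst R A B).toLinearMap = L := by
    refine le_antisymm ?_ fun a ha ↦ ?_
    · rintro _ ⟨q, hq, rfl⟩
      exact hq.2.1
    · obtain ⟨b, hb, hab⟩ := hLM a ha
      exact ⟨(a, b), ⟨hab, ha, hb⟩, rfl⟩
  have hsnd : Q.map (AlgHom.snd R A B).toLinearMap = M := by
    refine le_antisymm ?_ fun b hb ↦ ?_
    · rintro _ ⟨q, hq, rfl⟩
      exact hq.2.2
    · obtain ⟨a, ha, hab⟩ := hML b hb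
      exact ⟨(a, b), ⟨hab, ha, hb⟩, rfl⟩
  have hP : ∀ k, Q ^ k ≤ P.toSubmodule := by
    intro k
    induction k with
    | zero => rw [pow_zero, Submodule.one_le]; exact P.one_mem
    | succ k ih =>
      rw [pow_succ, Submodule.mul_le]
      exact fun a ha b hb ↦ P.mul_mem (ih ha) hb.1
  rw [← hfst, ← Submodule.map_pow] at hx
  obtain ⟨q, hq, rfl⟩ := hx
  have hb : (AlgHom.snd R A B) q ∈ M ^ l := by
    refine hM ?_
    rw [← hsnd, ← Submodule.map_pow]
    exact ⟨q, hq, rfl⟩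
  rw [← hsnd, ← Submodule.map_pow] at hb
  obtain ⟨q', hq', hqq'⟩ := hb
  refine ⟨q'.1, ?_, q.2, hP k hq, ?_⟩
  · rw [← hfst, ← Submodule.map_pow]
    exact ⟨q', hq', rfl⟩
  · have : q'.2 = q.2 := hqq'
    rw [← this]
    exact hP l hq'

variable {K V : Type*} [Field K] [AddCommGroup V] [Module K V]

/-- The pairs of endomorphisms intertwined by a linear map. -/
def intertwiners {U : Type*} [AddCommGroup U] [Module K U] (ι : V →ₗ[K] U) :
    Subalgebra K (End K V × End K U) where
  carrier := {p | ∀ v, ι (p.1 v) = p.2 (ι v)}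
  mul_mem' {p q} hp hq v := by simp [hp _, hq _]
  add_mem' {p q} hp hq v := by simp [hp _, hq _]
  algebraMap_mem' c v := by simp [Prod.algebraMap_apply, Module.algebraMap_end_apply]

/-- The pairs of endomorphisms intertwined by a linear map, in the other order. -/
def cointertwiners {U : Type*} [AddCommGroup U] [Module K U] (ι : U →ₗ[K] V) :
    Subalgebra K (End K V × End K U) where
  carrier := {p | ∀ u, ι (p.2 u) = p.1 (ι u)}
  mul_mem' {p q} hp hq v := by simp [hp _, hq _]
  add_mem' {p q} hp hq v := by simp [hp _, hq _]
  algebraMap_mem' c v := by simp [Prod.algebraMap_apply, Module.algebraMap_end_apply]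

/-- Shorten `x` to `y` agreeing with it on `W`, and `z` to `t` agreeing with it modulo `W`. Then `(x
- y) * (z - t) = 0` expresses `x * z` through shorter products. -/
theorem pow_le_pow_of_invariant {L : Submodule K (End K V)} (h1 : 1 ≤ L) {W : Submodule K V}
    (hW : ∀ a ∈ L, ∀ w ∈ W, a w ∈ W) {k l : ℕ}
    (hk : ∀ M : Submodule K (End K W), 1 ≤ M → M ^ (k + 1) ≤ M ^ k)
    (hl : ∀ M : Submodule K (End K (V ⧸ W)), 1 ≤ M → M ^ (l + 1) ≤ M ^ l) :
    L ^ (k + l + 2) ≤ L ^ (k + l + 1) := by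
  have hsub : ∀ x ∈ L ^ (k + 1), ∃ y ∈ L ^ k, ∀ w ∈ W, x w = y w := by
    intro x hx
    let P := cointertwiners W.subtype
    let M : Submodule K (End K W) :=
      (P.toSubmodule ⊓ L.comap (LinearMap.fst K _ _)).map (LinearMap.snd K _ _)
    have hM : 1 ≤ M := by
      rw [Submodule.one_le]
      have h1L : (1 : End K V) ∈ L := Submodule.one_le.mp h1
      exact ⟨1, ⟨P.one_mem, h1L⟩, rfl⟩
    obtain ⟨y, hy, b, hxb, hyb⟩ := exists_intertwining_pow P (L := L) (M := M)
      (fun a ha ↦ ⟨a.restrict (hW a ha), ⟨(a, a.restrict (hW a ha)), ⟨fun _ ↦ rfl, ha⟩, rfl⟩,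
        fun _ ↦ rfl⟩)
      (by rintro _ ⟨q, hq, rfl⟩; exact ⟨q.1, hq.2, hq.1⟩) (hk M hM) hx
    exact ⟨y, hy, fun w hw ↦ (hxb ⟨w, hw⟩).symm.trans (hyb ⟨w, hw⟩)⟩
  have hquo : ∀ x ∈ L ^ (l + 1), ∃ y ∈ L ^ l, ∀ v, x v - y v ∈ W := by
    intro x hx
    let P := intertwiners W.mkQ
    let M : Submodule K (End K (V ⧸ W)) :=
      (P.toSubmodule ⊓ L.comap (LinearMap.fst K _ _)).map (LinearMap.snd K _ _)
    have hM : 1 ≤ M := by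
      rw [Submodule.one_le]
      have h1L : (1 : End K V) ∈ L := Submodule.one_le.mp h1
      exact ⟨1, ⟨P.one_mem, h1L⟩, rfl⟩
    obtain ⟨y, hy, b, hxb, hyb⟩ := exists_intertwining_pow P (L := L) (M := M)
      (fun a ha ↦ ⟨W.mapQ W a (hW a ha), ⟨(a, W.mapQ W a (hW a ha)), ⟨fun _ ↦ rfl, ha⟩, rfl⟩,
        fun _ ↦ rfl⟩)
      (by rintro _ ⟨q, hq, rfl⟩; exact ⟨q.1, hq.2, hq.1⟩) (hl M hM) hx
    refine ⟨y, hy, fun v ↦ ?_⟩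
    have : W.mkQ (x v) = W.mkQ (y v) := (hxb v).trans (hyb v).symm
    exact (Submodule.Quotient.eq W).mp this
  have hmem : ∀ {i j : ℕ} {a b : End K V}, a ∈ L ^ i → b ∈ L ^ j → i + j ≤ k + l + 1 →
      a * b ∈ L ^ (k + l + 1) := by
    intro i j a b ha hb hij
    refine pow_le_pow_right' h1 hij ?_
    rw [pow_add]
    exact Submodule.mul_mem_mul ha hb
  rw [show k + l + 2 = (k + 1) + (l + 1) by ring, pow_add, Submodule.mul_le]
  intro x hx z hz
  obtain ⟨y, hy, hxy⟩ := hsub x hx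
  obtain ⟨t, ht, hzt⟩ := hquo z hz
  have h0 : (x - y) * (z - t) = 0 := by
    ext v
    simpa [sub_eq_zero] using hxy _ (hzt v)
  have : x * z = x * t + y * z - y * t := by
    rw [← sub_eq_zero, ← h0]
    noncomm_ring
  rw [this]
  exact Submodule.sub_mem _ (Submodule.add_mem _ (hmem hx ht (by omega)) (hmem hy hz (by omega)))
    (hmem hy ht (by omega))

end Reduction

/-- Paz's bound over algebraically closed fields in dimension at most five. -/
theorem pow_le_pow_of_finrank_le_five {K : Type*} [Field K] [IsAlgClosed K] (n : ℕ) (hn : n ≤ 5) :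
    ∀ (V : Type*) [AddCommGroup V] [Module K V] [FiniteDimensional K V], finrank K V = n →
      ∀ L : Submodule K (End K V), 1 ≤ L → L ^ (2 * n - 2 + 1) ≤ L ^ (2 * n - 2) := by
  induction n using Nat.strong_induction_on with
  | _ n ih =>
  intro V _ _ _ hV L h1
  by_cases hL : ActsIrreducibly L
  · rw [← hV, hL.pow_eq_top h1 (hV ▸ hn)]
    exact le_top
  · rw [ActsIrreducibly] at hL
    push Not at hL
    obtain ⟨W, hW, hbot, htop⟩ := hL
    have hsum := W.finrank_quotient_add_finrank
    have hlt := Submodule.finrank_lt htop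
    have hpos := Submodule.one_le_finrank_iff.mpr hbot
    have := pow_le_pow_of_invariant h1 hW (ih (finrank K W) (by omega) (by omega) W rfl)
      (ih (finrank K (V ⧸ W)) (by omega) (by omega) (V ⧸ W) rfl)
    -- Both pieces are nonzero, so no subtraction truncates.
    rw [show 2 * finrank K W - 2 + (2 * finrank K (V ⧸ W) - 2) + 2 = 2 * n - 2 by omega] at this
    rw [pow_succ]
    refine (mul_le_mul_left this L).trans ?_
    rw [← pow_succ]
    exact pow_le_pow_right' h1 (by omega)

/-! ### Descent of spans from an extension field -/

section BaseChange

open Matrix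

/-- An `F`-linear retraction `ψ : K → F`, applied entrywise, carries the `K`-span back into the
`F`-span. Quantifying over the multiplier `c` lets the induction pass through `K`-scalars. -/
theorem mem_span_of_map_mem_span {F K m n : Type*} [Field F] [Field K] [Algebra F K]
    {T : Set (Matrix m n F)} {x : Matrix m n F}
    (hx : x.map (algebraMap F K) ∈
      Submodule.span K ((fun a : Matrix m n F ↦ a.map (algebraMap F K)) '' T)) :
    x ∈ Submodule.span F T := by
  obtain ⟨ψ, hψ⟩ : ∃ ψ : K →ₗ[F] F, ψ ∘ₗ Algebra.linearMap F K = LinearMap.id :=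
    LinearMap.exists_leftInverse_of_injective _
      (LinearMap.ker_eq_bot.mpr (algebraMap F K).injective)
  have hψ' : ∀ c : F, ψ (algebraMap F K c) = c := LinearMap.congr_fun hψ
  have key : ∀ y ∈ Submodule.span K ((fun a : Matrix m n F ↦ a.map (algebraMap F K)) '' T),
      ∀ c : K, (c • y).map ψ ∈ Submodule.span F T := by
    intro y hy
    induction hy using Submodule.span_induction with
    | mem _ h =>
      obtain ⟨a, ha, rfl⟩ := h
      intro c
      convert Submodule.smul_mem _ (ψ c) (Submodule.subset_span ha) using 1
      ext i j
      simp [mul_comm c, ← Algebra.smul_def, mul_comm (ψ c)]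
    | zero => intro c; simp [Matrix.map_zero]
    | add x y _ _ hx hy =>
      intro c
      rw [smul_add, Matrix.map_add _ (map_add ψ)]
      exact add_mem (hx c) (hy c)
    | smul d x _ hx => intro c; rw [smul_smul]; exact hx _
  have := key _ hx 1
  rw [one_smul] at this
  rwa [Matrix.map_map, show ψ ∘ algebraMap F K = id from funext hψ', Matrix.map_id] at this

end BaseChange

/-! ### Word length and powers of a span -/

section Length

open scoped Pointwise

variable {F A : Type*} [Field F] [Ring A] [Algebra F A]

theorem mem_wordsOfLength_of_mem_insert_pow (S : Set A) {k : ℕ} {a : A}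
    (ha : a ∈ (insert 1 S) ^ k) : ∃ i ≤ k, a ∈ wordsOfLength S i := by
  induction k generalizing a with
  | zero => exact ⟨0, le_rfl, [], rfl, by simp, by simpa using ha.symm⟩
  | succ k ih =>
    rw [pow_succ'] at ha
    obtain ⟨x, hx, y, hy, rfl⟩ := ha
    obtain ⟨i, hi, w, hw, hwS, rfl⟩ := ih hy
    rcases hx with rfl | hx
    · exact ⟨i, by omega, w, hw, hwS, by simp⟩
    · exact ⟨i + 1, by omega, x :: w, by simp [hw], by simpa using ⟨hx, hwS⟩, by simp⟩

theorem mul_mem_insert_pow (S : Set A) {k : ℕ} {a x : A} (hx : x ∈ S)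
    (ha : a ∈ (insert 1 S) ^ k) : x * a ∈ (insert 1 S) ^ (k + 1) := by
  rw [pow_succ']
  exact Set.mul_mem_mul (Set.mem_insert_of_mem 1 hx) ha

/-- Padding with the letter `1` turns words of length at most `k` into words of length exactly `k`.
-/
theorem spanWordsLE_eq (S : Set A) (k : ℕ) :
    spanWordsLE F S k = Submodule.span F (insert 1 S) ^ k := by
  rw [Submodule.span_pow]
  refine le_antisymm (Submodule.span_mono ?_)
    (Submodule.span_mono fun a ha ↦ mem_wordsOfLength_of_mem_insert_pow S ha)
  rintro _ ⟨i, hi, w, rfl, hwS, rfl⟩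
  refine Set.pow_subset_pow_right (Set.mem_insert 1 S) hi ?_
  clear hi
  induction w with
  | nil => simp [pow_zero]
  | cons x w ih =>
    rw [List.prod_cons, List.length_cons]
    exact mul_mem_insert_pow S (hwS x (by simp)) (ih fun y hy ↦ hwS y (by simp [hy]))

theorem spanWordsLE_eq_adjoin {S : Set A} {k : ℕ}
    (h : Submodule.span F (insert 1 S) ^ (k + 1) ≤ Submodule.span F (insert 1 S) ^ k) :
    spanWordsLE F S k = Subalgebra.toSubmodule (Algebra.adjoin F S) := by
  refine le_antisymm (Submodule.span_le.mpr ?_) ?_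
  · rintro _ ⟨i, -, w, -, hwS, rfl⟩
    exact Subalgebra.list_prod_mem _ fun x hx ↦ Algebra.subset_adjoin (hwS x hx)
  · rw [spanWordsLE_eq, Algebra.adjoin_eq_span, Submodule.span_le]
    intro a ha
    induction ha using Submonoid.closure_induction_left with
    | one =>
      exact Submodule.one_le.mp (one_le_pow_of_one_le'
        (Submodule.one_le.mpr (Submodule.subset_span (Set.mem_insert 1 S))) k)
    | mul_left x hx y _ ih =>
      refine h ?_
      rw [pow_succ']
      exact Submodule.mul_mem_mul (Submodule.subset_span (Set.mem_insert_of_mem 1 hx)) ih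

theorem algLength_le {S : Set A} {k : ℕ}
    (h : Submodule.span F (insert 1 S) ^ (k + 1) ≤ Submodule.span F (insert 1 S) ^ k) :
    algLength F S ≤ k :=
  sInf_le ⟨k, spanWordsLE_eq_adjoin h, rfl⟩

end Length

open scoped Pointwise in
theorem matrix_span_pow_le {F : Type*} [Field F] (n : ℕ) (hn : n ≤ 5)
    (S : Set (Matrix (Fin n) (Fin n) F)) :
    Submodule.span F (insert 1 S) ^ (2 * n - 2 + 1) ≤ Submodule.span F (insert 1 S) ^ (2 * n - 2) := by
  let K := AlgebraicClosure F
  let φ : Matrix (Fin n) (Fin n) F →ₐ[F] Matrix (Fin n) (Fin n) K := (Algebra.ofId F K).mapMatrix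
  let e : Matrix (Fin n) (Fin n) K ≃ₐ[K] End K (Fin n → K) := Matrix.toLinAlgEquiv'
  let M : Submodule K (Matrix (Fin n) (Fin n) K) := Submodule.span K (φ '' insert 1 S)
  have hM : M ^ (2 * n - 2 + 1) ≤ M ^ (2 * n - 2) := by
    have := pow_le_pow_of_finrank_le_five n hn (Fin n → K) (by simp) (M.map e.toLinearMap) (by
      rw [Submodule.one_le]
      exact ⟨1, Submodule.subset_span ⟨1, Set.mem_insert 1 S, map_one φ⟩, map_one e⟩)
    have hpow : ∀ k, (M.map e.toLinearMap) ^ k = (M ^ k).map e.toLinearMap := fun k ↦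
      (Submodule.map_pow M e.toAlgHom k).symm
    rw [hpow, hpow] at this
    exact (Submodule.map_le_map_iff_of_injective e.injective _ _).mp this
  have himage : ∀ k, M ^ k = Submodule.span K (φ '' (insert 1 S) ^ k) := fun k ↦ by
    rw [Submodule.span_pow, Set.image_pow]
  rw [himage, himage] at hM
  rw [Submodule.span_pow, Submodule.span_pow, Submodule.span_le]
  intro x hx
  exact mem_span_of_map_mem_span (K := K) (hM (Submodule.subset_span ⟨x, hx, rfl⟩))

theorem theorem3 {F : Type*} [Field F] (S : Set (Matrix (Fin 5) (Fin 5) F)) :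
    algLength F S ≤ 8 :=
  algLength_le (matrix_span_pow_le 5 le_rfl S)
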